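/- All graphs are finite and simple. For a graph $H$, the square $H^2$ has the same vertex set as $H$, with two distinct vertices adjacent if and only if their distance in $H$ is at most $2$. A graph $G$ is equitably $k$-choosable if, for every assignment $L$ of a list $L(v)$ of exactly $k$ colors to each vertex $v$ of $G$, there is a proper coloring $f$ of $G$ with $f(v)\in L(v)$ for all $v$ in which each color is used on at most $\lceil |V(G)|/k\rceil$ vertices. Theorem. Let $G$ be a graph each of whose connected components is the square $P_n^2$ of a path, the square $C_n^2$ of a cycle on $n\ge 6$ vertices, or a copy of $K_4$. Then $G$ is equitably $4$-choosable. Moreover, $G$ is equitably $3$-choosable if and only if no component of $G$ is a copy of $K_4$ and every component of $G$ that is the square of a cycle on at least $6$ vertices has order divisible by $3$. -/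

import Mathlib

/-- The `p`-th power of a graph: same vertices, and two distinct vertices are adjacent when their
distance in `G` is at most `p` (`edist` is infinite between different components). -/
def graphPower {V : Type*} (G : SimpleGraph V) (p : ℕ) : SimpleGraph V where
  Adj u v := u ≠ v ∧ G.edist u v ≤ (p : ℕ∞)
  symm := ⟨fun _ _ h => ⟨h.1.symm, SimpleGraph.edist_comm.trans_le h.2⟩⟩
  loopless := ⟨fun _ h => h.1 rfl⟩

/-- `H` is isomorphic to the square of a path. -/
def IsPathSquare {V : Type*} (H : SimpleGraph V) : Prop :=
  ∃ n : ℕ, Nonempty (H ≃g graphPower (SimpleGraph.pathGraph n) 2)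

/-- `H` is isomorphic to the square of a cycle on at least 6 vertices. -/
def IsCycleSquare {V : Type*} (H : SimpleGraph V) : Prop :=
  ∃ n : ℕ, 6 ≤ n ∧ Nonempty (H ≃g graphPower (SimpleGraph.cycleGraph n) 2)

/-- `H` is a copy of the complete graph on 4 vertices. -/
def IsK4 {V : Type*} (H : SimpleGraph V) : Prop :=
  Nonempty (H ≃g (⊤ : SimpleGraph (Fin 4)))

/-- For every assignment of `k`-element lists of colors to the vertices, `G` has a proper coloring
from the lists in which every color is used on at most `⌈|V(G)| / k⌉` vertices. -/
def IsEquitablyChoosable {V : Type*} [Fintype V] (G : SimpleGraph V) (k : ℕ) : Prop :=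
  ∀ (C : Type) [DecidableEq C] (L : V → Finset C), (∀ v, (L v).card = k) →
    ∃ f : G.Coloring C, (∀ v, f v ∈ L v) ∧
      ∀ c : C, (Finset.univ.filter (fun v => f v = c)).card ≤ ⌈(Fintype.card V : ℚ) / (k : ℚ)⌉₊

/-!
Everything rests on a form of list colorability that survives disjoint unions. Read the vertices
as filling groups of `k`: after `N` vertices there are `N / k` full groups and one partial group
with color set `B` of size `N % k`, and each color `c` has been used at most `N / k` times, once
more if `c ∈ B`. A graph is *balanced choosable* (`IsBalancedChoosable`) if, starting from any
`B`, it can be list-colored so that this bookkeeping continues. Coloring the components one after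
the other then gives an equitable coloring (`isEquitablyChoosable_of_components`), so each kind of
component can be treated alone.

* Squares of paths, `k ≥ 3`: color greedily from left to right, avoiding `B` and the last two
  colors. The last color lies in `B` unless `B` is empty, and the last two do if `B` has at least
  two elements, so fewer than `k` colors are forbidden
  (`exists_balanced_pathSquare_run`).
* Squares of cycles, `k = 4` (`exists_balanced_cycleSquare_run`): color `n % 4` vertices as on a
  path, and then groups of four consecutive vertices with four distinct colors, which leave `B`
  unchanged. In the last group `a b c d` the colors already used forbid at most two colors at `a`
  and `d`, and one each at `b` (the color `x` before the group) and `c` (the color `y` of vertex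
  `0`). The group can be completed as soon as what is left for `b` and `c` has at least four colors
  in total. For given `y` this excludes at most one `x`, which the preceding group can avoid. When
  `n` is 6 or 7 there is no preceding group, but then `x ≠ y`, and among such pairs only one is bad.
* Squares of cycles with `n = 3m` vertices, `k = 3`: every color class has at most `m` vertices,
  so only a list coloring is needed. The graph polynomial
  `P = ∏ i, (X i - X (i + 1)) * (X i - X (i + 2))` has degree at most `2n`, so by Lagrange
  interpolation a weighted sum of its values over a grid of 3-element sets depends on `P` alone
  (`sum_piFinset_eval_mul_nodeWeight`). On the grid `{0, 1, 2}ⁿ` each proper coloring contributes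
  exactly `1` to this sum, so the sum is positive. Hence `P` does not vanish on any such grid.

Conversely, with all lists equal, `K₄` is not 3-colorable, and a 3-coloring of the square of a
cycle has period 3, which forces `3 ∣ n`.
-/

/-! ### List colorings from the graph polynomial -/

section Algebraic
open MvPolynomial Finset

/-- The Lagrange weight of a node `c` of `S`: the leading coefficient of the polynomial that is `1`
at `c` and `0` at the other points of `S`. -/
noncomputable def nodeWeight (S : Finset ℚ) (c : ℚ) : ℚ := ∏ d ∈ S.erase c, (c - d)⁻¹

/-- On three nodes, the weighted sum of the values of a polynomial of degree at most 2 is its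
leading coefficient (as a quadratic). -/
theorem sum_nodeWeight_mul_pow {S : Finset ℚ} (hS : S.card = 3) {e : ℕ} (he : e ≤ 2) :
    ∑ c ∈ S, c ^ e * nodeWeight S c = if e = 2 then 1 else 0 := by
  obtain ⟨a, b, c, hab, hac, hbc, rfl⟩ := Finset.card_eq_three.1 hS
  have ea : ({a, b, c} : Finset ℚ).erase a = {b, c} := by grind
  have eb : ({a, b, c} : Finset ℚ).erase b = {a, c} := by grind
  have ec : ({a, b, c} : Finset ℚ).erase c = {a, b} := by grind
  have h1 : a - b ≠ 0 := sub_ne_zero.2 hab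
  have h2 : a - c ≠ 0 := sub_ne_zero.2 hac
  have h3 : b - c ≠ 0 := sub_ne_zero.2 hbc
  have h1' : b - a ≠ 0 := sub_ne_zero.2 hab.symm
  have h2' : c - a ≠ 0 := sub_ne_zero.2 hac.symm
  have h3' : c - b ≠ 0 := sub_ne_zero.2 hbc.symm
  rw [Finset.sum_insert (by simp [hab, hac]), Finset.sum_pair hbc]
  simp only [nodeWeight, ea, eb, ec]
  rw [Finset.prod_pair hbc, Finset.prod_pair hac, Finset.prod_pair hab]
  interval_cases e <;> norm_num <;> field_simp <;> ring

variable {ι : Type*} [Fintype ι] [DecidableEq ι]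

/-- For `P` of degree at most twice the number of variables, the weighted sum of its values over a
grid of 3-element sets is the coefficient of `∏ i, X i ^ 2`. In particular it is the same for all
grids. -/
theorem sum_piFinset_eval_mul_nodeWeight {S : ι → Finset ℚ} (hS : ∀ i, (S i).card = 3)
    {P : MvPolynomial ι ℚ} (hP : P.totalDegree ≤ 2 * Fintype.card ι) :
    ∑ x ∈ Fintype.piFinset S, eval x P * ∏ i, nodeWeight (S i) (x i) =
      ∑ e ∈ P.support, P.coeff e * if ∀ i, e i = 2 then 1 else 0 := by
  simp_rw [eval_eq', Finset.sum_mul]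
  rw [Finset.sum_comm]
  refine Finset.sum_congr rfl fun e he => ?_
  simp_rw [mul_assoc, ← Finset.prod_mul_distrib]
  rw [← Finset.mul_sum,
    ← Finset.prod_univ_sum S (fun i c => c ^ e i * nodeWeight (S i) c)]
  congr 1
  have hdeg : ∑ i, e i ≤ ∑ _i : ι, 2 := by
    have := (le_totalDegree he).trans hP
    rw [Finsupp.sum_fintype _ _ (by simp)] at this
    simpa [mul_comm] using this
  by_cases h2 : ∀ i, e i = 2
  · rw [if_pos h2]
    exact Finset.prod_eq_one fun i _ => by
      rw [sum_nodeWeight_mul_pow (hS i) (h2 i).le, if_pos (h2 i)]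
  · rw [if_neg h2]
    obtain ⟨i, hi⟩ : ∃ i, e i < 2 := by
      by_contra! hge
      exact h2 fun i => (((Finset.sum_eq_sum_iff_of_le fun i _ => hge i).1
        (le_antisymm (Finset.sum_le_sum fun i _ => hge i) hdeg)) i (Finset.mem_univ i)).symm
    exact Finset.prod_eq_zero (Finset.mem_univ i) (by
      rw [sum_nodeWeight_mul_pow (hS i) hi.le, if_neg hi.ne])

/-- Rational list coloring for the graph joining `i` to `s i` and `s (s i)`: one proper coloring `g`
with the colors `0, 1, 2` yields proper colorings from all lists of size 3. -/
theorem exists_rat_listColoring (s : ι → ι) (g : ι → ℚ)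
    (hg : ∀ i, g i ∈ ({0, 1, 2} : Finset ℚ)) (h1 : ∀ i, g i ≠ g (s i))
    (h2 : ∀ i, g i ≠ g (s (s i))) (S : ι → Finset ℚ) (hS : ∀ i, (S i).card = 3) :
    ∃ x : ι → ℚ, (∀ i, x i ∈ S i) ∧ ∀ i, x i ≠ x (s i) ∧ x i ≠ x (s (s i)) := by
  set P : MvPolynomial ι ℚ := ∏ i, ((X i - X (s i)) * (X i - X (s (s i)))) with hPdef
  have heval : ∀ x : ι → ℚ, eval x P = ∏ i, ((x i - x (s i)) * (x i - x (s (s i)))) := by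
    intro x; simp [hPdef, map_prod]
  have hP : P.totalDegree ≤ 2 * Fintype.card ι := by
    have hX : ∀ i j : ι, (X i - X j : MvPolynomial ι ℚ).totalDegree ≤ 1 := fun i j =>
      (totalDegree_sub _ _).trans (by simp [totalDegree_X])
    refine (totalDegree_finsetProd _ _).trans ?_
    refine (Finset.sum_le_card_nsmul _ _ 2 fun i _ => ?_).trans (by simp [mul_comm])
    exact (totalDegree_mul _ _).trans (add_le_add (hX _ _) (hX _ _))
  set T : Finset ℚ := {0, 1, 2} with hT
  have hTc : T.card = 3 := by rw [hT]; norm_num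
  -- A nonzero term for the lists `{0, 1, 2}` comes from a proper coloring. There `i`, `s i` and
  -- `s (s i)` have all three colors, so the factor of `P` at `i` cancels the weight at `i`.
  have hterm : ∀ x ∈ Fintype.piFinset (fun _ : ι => T), eval x P ≠ 0 →
      eval x P * ∏ i, nodeWeight T (x i) = 1 := by
    intro x hx hne
    rw [heval] at hne ⊢
    have hfac := fun i => Finset.prod_ne_zero_iff.1 hne i (Finset.mem_univ i)
    have a1 : ∀ i, x i ≠ x (s i) := fun i => sub_ne_zero.1 (left_ne_zero_of_mul (hfac i))
    have a2 : ∀ i, x i ≠ x (s (s i)) := fun i => sub_ne_zero.1 (right_ne_zero_of_mul (hfac i))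
    have hmem : ∀ i, x i ∈ T := Fintype.mem_piFinset.1 hx
    rw [← Finset.prod_mul_distrib]
    refine Finset.prod_eq_one fun i _ => ?_
    have he : T.erase (x i) = {x (s i), x (s (s i))} := by
      symm
      apply Finset.eq_of_subset_of_card_le
      · intro c hc
        rw [Finset.mem_insert, Finset.mem_singleton] at hc
        rcases hc with rfl | rfl
        · exact Finset.mem_erase.2 ⟨(a1 i).symm, hmem _⟩
        · exact Finset.mem_erase.2 ⟨(a2 i).symm, hmem _⟩
      · rw [Finset.card_erase_of_mem (hmem i), hTc, Finset.card_pair (a1 (s i))]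
    rw [nodeWeight, he, Finset.prod_pair (a1 (s i)), ← mul_inv]
    exact mul_inv_cancel₀ (hfac i)
  have hgP : eval g P ≠ 0 := by
    rw [heval]
    exact Finset.prod_ne_zero_iff.2 fun i _ =>
      mul_ne_zero (sub_ne_zero.2 (h1 i)) (sub_ne_zero.2 (h2 i))
  have hgmem : g ∈ Fintype.piFinset (fun _ : ι => T) := Fintype.mem_piFinset.2 hg
  have hpos : 0 < ∑ x ∈ Fintype.piFinset (fun _ : ι => T),
      eval x P * ∏ i, nodeWeight T (x i) := by
    refine Finset.sum_pos' (fun x hx => ?_) ⟨g, hgmem, ?_⟩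
    · by_cases h0 : eval x P = 0
      · simp [h0]
      · rw [hterm x hx h0]; exact zero_le_one
    · rw [hterm g hgmem hgP]; exact one_pos
  rw [sum_piFinset_eval_mul_nodeWeight (fun _ => hTc) hP,
    ← sum_piFinset_eval_mul_nodeWeight hS hP] at hpos
  obtain ⟨x, hx, hne⟩ := Finset.exists_ne_zero_of_sum_ne_zero hpos.ne'
  have hne' := left_ne_zero_of_mul hne
  rw [heval] at hne'
  have hfac := fun i => Finset.prod_ne_zero_iff.1 hne' i (Finset.mem_univ i)
  exact ⟨x, Fintype.mem_piFinset.1 hx, fun i =>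
    ⟨sub_ne_zero.1 (left_ne_zero_of_mul (hfac i)), sub_ne_zero.1 (right_ne_zero_of_mul (hfac i))⟩⟩

/-- If the graph joining each `i` to `s i` and `s (s i)` is 3-colorable, then it is 3-choosable. -/
theorem exists_listColoring_of_card_eq_three (s : ι → ι) (g : ι → Fin 3)
    (h1 : ∀ i, g i ≠ g (s i)) (h2 : ∀ i, g i ≠ g (s (s i)))
    {C : Type*} [DecidableEq C] (L : ι → Finset C) (hL : ∀ i, (L i).card = 3) :
    ∃ f : ι → C, (∀ i, f i ∈ L i) ∧ ∀ i, f i ≠ f (s i) ∧ f i ≠ f (s (s i)) := by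
  classical
  -- Only finitely many colors occur; name them by distinct rationals.
  let U : Finset C := Finset.univ.biUnion L
  let φ : C → ℚ := fun c => if h : c ∈ U then ((U.equivFin ⟨c, h⟩ : ℕ) : ℚ) else 0
  have hφ : Set.InjOn φ U := by
    intro a ha b hb hab
    have ha' : a ∈ U := ha
    have hb' : b ∈ U := hb
    simp only [φ, dif_pos ha', dif_pos hb', Nat.cast_inj] at hab
    exact congrArg Subtype.val (U.equivFin.injective (Fin.ext hab))
  have hLU : ∀ i, L i ⊆ U := fun i => Finset.subset_biUnion_of_mem L (Finset.mem_univ i)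
  have hinj3 : Function.Injective fun a : Fin 3 => ((a : ℕ) : ℚ) := fun a b h =>
    Fin.ext (Nat.cast_injective h)
  obtain ⟨x, hx, hne⟩ := exists_rat_listColoring s (fun i => ((g i : ℕ) : ℚ))
    (fun i => by
      have : ∀ a : Fin 3, ((a : ℕ) : ℚ) ∈ ({0, 1, 2} : Finset ℚ) := by
        intro a; fin_cases a <;> simp
      exact this _)
    (fun i => hinj3.ne (h1 i)) (fun i => hinj3.ne (h2 i)) (fun i => (L i).image φ)
    (fun i => by rw [Finset.card_image_of_injOn (hφ.mono (Finset.coe_subset.2 (hLU i))), hL])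
  choose f hf hfx using fun i => Finset.mem_image.1 (hx i)
  exact ⟨f, hf, fun i => ⟨fun h => (hne i).1 (by rw [← hfx, ← hfx, h]),
    fun h => (hne i).2 (by rw [← hfx, ← hfx, h])⟩⟩

end Algebraic

/-! ### Adjacency in squares of paths and cycles -/

section Adjacency

variable {W : Type*}

theorem graphPower_two_adj {H : SimpleGraph W} {u v : W} :
    (graphPower H 2).Adj u v ↔ u ≠ v ∧ (H.Adj u v ∨ ∃ w, H.Adj u w ∧ H.Adj w v) := by
  refine and_congr_right fun huv => ⟨fun h => ?_, ?_⟩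
  · obtain ⟨p, hp⟩ := SimpleGraph.exists_walk_of_edist_ne_top
      (ne_top_of_le_ne_top (ENat.natCast_ne_top 2) h)
    have hlen : p.length ≤ 2 := by rw [← hp] at h; exact_mod_cast h
    match p, hlen with
    | .nil, _ => exact absurd rfl huv
    | .cons h₁ .nil, _ => exact Or.inl h₁
    | .cons h₁ (.cons h₂ .nil), _ => exact Or.inr ⟨_, h₁, h₂⟩
    | .cons _ (.cons _ (.cons _ _)), h3 =>
      simp only [SimpleGraph.Walk.length_cons] at h3
      omega
  · rintro (h | ⟨w, h₁, h₂⟩)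
    · exact (SimpleGraph.edist_le h.toWalk).trans (by simp)
    · exact (SimpleGraph.edist_le (.cons h₁ (.cons h₂ .nil))).trans (by simp)

theorem pathSquare_adj_val {n : ℕ} {u v : Fin n}
    (h : (graphPower (SimpleGraph.pathGraph n) 2).Adj u v) :
    u ≠ v ∧ (u : ℕ) ≤ v + 2 ∧ (v : ℕ) ≤ u + 2 := by
  obtain ⟨hne, h⟩ := graphPower_two_adj.1 h
  refine ⟨hne, ?_⟩
  simp only [SimpleGraph.pathGraph_adj] at h
  rcases h with h | ⟨w, h₁, h₂⟩ <;> omega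

theorem cycleGraph_adj_val {n : ℕ} (hn : 2 ≤ n) {u v : Fin n} :
    (SimpleGraph.cycleGraph n).Adj u v ↔
      (u : ℕ) + 1 = v ∨ (v : ℕ) + 1 = u ∨ (u : ℕ) + 1 = v + n ∨ (v : ℕ) + 1 = u + n := by
  have hu := u.2
  have hv := v.2
  have key : ∀ a b : Fin n, (a - b).val = 1 ↔ (b : ℕ) + 1 = a ∨ (b : ℕ) + 1 = a + n := by
    intro a b
    have ha := a.2
    have hb := b.2
    rw [Fin.sub_def]
    simp only
    rcases le_or_gt (b : ℕ) a with hab | hab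
    · have : n - (b : ℕ) + a = (a - b) + n := by omega
      rw [this, Nat.add_mod_right, Nat.mod_eq_of_lt (by omega)]
      omega
    · rw [Nat.mod_eq_of_lt (by omega)]
      omega
  rw [SimpleGraph.cycleGraph_adj', key, key]
  tauto

theorem cycleSquare_adj_val {n : ℕ} (hn : 6 ≤ n) {u v : Fin n} :
    (graphPower (SimpleGraph.cycleGraph n) 2).Adj u v ↔
      u ≠ v ∧ (((u : ℕ) ≤ v + 2 ∧ (v : ℕ) ≤ u + 2) ∨ (v : ℕ) + n ≤ u + 2 ∨ (u : ℕ) + n ≤ v + 2) := by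
  rw [graphPower_two_adj]
  refine and_congr_right fun huv => ?_
  have hu := u.2
  have hv := v.2
  have huv' : (u : ℕ) ≠ v := fun h => huv (Fin.ext h)
  simp only [cycleGraph_adj_val (by omega : 2 ≤ n)]
  constructor
  · rintro (h | ⟨w, h₁, h₂⟩)
    · omega
    · have := w.2
      omega
  · intro h
    by_cases h1 : (u : ℕ) + 1 = v ∨ (v : ℕ) + 1 = u ∨ (u : ℕ) + 1 = v + n ∨ (v : ℕ) + 1 = u + n
    · exact Or.inl h1
    · right
      by_cases hw : (u : ℕ) + 2 = v ∨ (u : ℕ) + 2 = v + n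
      · by_cases hl : (u : ℕ) + 1 < n
        · exact ⟨⟨u + 1, hl⟩, by dsimp only; omega, by dsimp only; omega⟩
        · exact ⟨⟨0, by omega⟩, by dsimp only; omega, by dsimp only; omega⟩
      · by_cases hl : (v : ℕ) + 1 < n
        · exact ⟨⟨v + 1, hl⟩, by dsimp only; omega, by dsimp only; omega⟩
        · exact ⟨⟨0, by omega⟩, by dsimp only; omega, by dsimp only; omega⟩

/-- The square of a cycle on `n ≥ 6` vertices is 3-colorable only when `3 ∣ n`: three consecutive
vertices get all three colors, so the colors repeat with period 3. -/
theorem three_dvd_of_cycleSquare_coloring {n : ℕ} (hn : 6 ≤ n)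
    (f : (graphPower (SimpleGraph.cycleGraph n) 2).Coloring (Fin 3)) : 3 ∣ n := by
  have hf : ∀ i j (hi : i < n) (hj : j < n), i ≠ j → ((i ≤ j + 2 ∧ j ≤ i + 2) ∨ j + n ≤ i + 2) →
      f ⟨i, hi⟩ ≠ f ⟨j, hj⟩ := fun i j hi hj hne h =>
    f.valid ((cycleSquare_adj_val hn).2 ⟨fun he => hne (Fin.mk.inj_iff.1 he), by
      simp only; omega⟩)
  have h3 : ∀ a b c d : Fin 3, a ≠ b → a ≠ c → b ≠ c → d ≠ b → d ≠ c → d = a := by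
    intro a b c d; omega
  have hmod : ∀ i (hi : i < n), f ⟨i, hi⟩ = f ⟨i % 3, by omega⟩ := by
    intro i
    induction i using Nat.strong_induction_on with
    | _ i ih =>
      intro hi
      by_cases h : i < 3
      · simp only [Nat.mod_eq_of_lt h]
      · have hlast : f ⟨i, hi⟩ = f ⟨i - 3, by omega⟩ :=
          h3 _ (f ⟨i - 2, by omega⟩) (f ⟨i - 1, by omega⟩) _
            (hf _ _ _ _ (by omega) (by omega)) (hf _ _ _ _ (by omega) (by omega))
            (hf _ _ _ _ (by omega) (by omega)) (hf _ _ _ _ (by omega) (by omega))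
            (hf _ _ _ _ (by omega) (by omega))
        rw [hlast, ih (i - 3) (by omega)]
        congr 2
        omega
  -- Otherwise the last or the second to last vertex repeats the color of vertex `0`.
  by_contra hdvd
  have hr : (n - 1) % 3 = 0 ∨ (n - 2) % 3 = 0 := by omega
  rcases hr with hr | hr
  · have := hmod (n - 1) (by omega)
    simp only [hr] at this
    exact hf _ _ _ _ (by omega) (by omega) this
  · have := hmod (n - 2) (by omega)
    simp only [hr] at this
    exact hf _ _ _ _ (by omega) (by omega) this

end Adjacency

/-! ### Balanced runs and squares of paths -/

section Runs

open Finset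

variable {C : Type*} [DecidableEq C]

/-- The first `m` colors of the sequence `f` continue a balanced count from state `B` to state
`B'`. Here `B` is the set of colors of a partly filled group of `k` vertices, and the vertices of
that group count as already colored; `B'` is the same after `m` more vertices. -/
def IsBalancedRun (k : ℕ) (B : Finset C) (f : ℕ → C) (m : ℕ) (B' : Finset C) : Prop :=
  B'.card = (B.card + m) % k ∧
    ∀ c, ((range m).filter fun i => f i = c).card + (if c ∈ B then 1 else 0) ≤
      (B.card + m) / k + (if c ∈ B' then 1 else 0)

/-- The first `m` terms of `f` properly color the square of the path `0, 1, …, m - 1`. -/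
def IsSquareProper (f : ℕ → C) (m : ℕ) : Prop :=
  ∀ i j, i < j → j < m → j ≤ i + 2 → f i ≠ f j

variable {k m : ℕ} {B B' : Finset C} {f g : ℕ → C}

theorem isBalancedRun_zero (hB : B.card < k) : IsBalancedRun k B f 0 B := by
  refine ⟨by simp [Nat.mod_eq_of_lt hB], fun c => by simp⟩

theorem IsBalancedRun.congr (h : IsBalancedRun k B f m B') (hfg : ∀ i < m, g i = f i) :
    IsBalancedRun k B g m B' := by
  refine ⟨h.1, fun c => ?_⟩
  rw [Finset.filter_congr (q := fun i => f i = c)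
    (fun i hi => by rw [hfg i (Finset.mem_range.1 hi)])]
  exact h.2 c

theorem card_filter_range_succ (f : ℕ → C) (m : ℕ) (c : C) :
    ((range (m + 1)).filter fun i => f i = c).card =
      ((range m).filter fun i => f i = c).card + if f m = c then 1 else 0 := by
  rw [Finset.range_add_one, Finset.filter_insert]
  split_ifs with h
  · rw [Finset.card_insert_of_notMem (by simp)]
  · simp

/-- A new color outside the partial group joins it, and the group is discarded when it is full. -/
theorem IsBalancedRun.succ (hk : 0 < k) (h : IsBalancedRun k B f m B') (hm : f m ∉ B') :
    IsBalancedRun k B f (m + 1) (if B'.card + 1 = k then ∅ else insert (f m) B') := by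
  obtain ⟨h1, h2⟩ := h
  have hlt : (B.card + m) % k < k := Nat.mod_lt _ hk
  have hdm := Nat.div_add_mod (B.card + m) k
  split_ifs with hc
  · have e : B.card + (m + 1) = k * ((B.card + m) / k + 1) := by rw [mul_add]; omega
    refine ⟨by simp [e], fun c => ?_⟩
    rw [card_filter_range_succ, e, Nat.mul_div_cancel_left _ hk]
    have := h2 c
    by_cases hc' : f m = c
    · subst hc'
      simp only [hm, if_false, if_true, Finset.notMem_empty] at this ⊢
      omega
    · simp only [hc', if_false, Finset.notMem_empty]
      split_ifs at this ⊢ <;> omega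
  · have e : B.card + (m + 1) = (B'.card + 1) + k * ((B.card + m) / k) := by omega
    have hlt' : B'.card + 1 < k := by omega
    refine ⟨?_, fun c => ?_⟩
    · rw [Finset.card_insert_of_notMem hm, e, Nat.add_mul_mod_self_left, Nat.mod_eq_of_lt hlt']
    · rw [card_filter_range_succ, e, Nat.add_mul_div_left _ _ hk, Nat.div_eq_of_lt hlt', zero_add]
      have := h2 c
      by_cases hc' : f m = c
      · subst hc'
        simp only [hm, if_false, if_true, Finset.mem_insert_self] at this ⊢
        omega
      · simp only [hc', if_false, Finset.mem_insert, Ne.symm hc', false_or]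
        omega

/-- Four distinct colors form a full group of their own, so the partial group stays. -/
theorem IsBalancedRun.add_four (h : IsBalancedRun 4 B f m B')
    (hinj : ∀ i j, m ≤ i → i < j → j < m + 4 → f i ≠ f j) :
    IsBalancedRun 4 B f (m + 4) B' := by
  obtain ⟨h1, h2⟩ := h
  refine ⟨by rw [h1]; omega, fun c => ?_⟩
  have := h2 c
  have e : (B.card + (m + 4)) / 4 = (B.card + m) / 4 + 1 := by omega
  rw [e, card_filter_range_succ, card_filter_range_succ, card_filter_range_succ,
    card_filter_range_succ]
  have h01 := hinj m (m + 1) (by omega) (by omega) (by omega)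
  have h02 := hinj m (m + 2) (by omega) (by omega) (by omega)
  have h03 := hinj m (m + 3) (by omega) (by omega) (by omega)
  have h12 := hinj (m + 1) (m + 2) (by omega) (by omega) (by omega)
  have h13 := hinj (m + 1) (m + 3) (by omega) (by omega) (by omega)
  have h23 := hinj (m + 2) (m + 3) (by omega) (by omega) (by omega)
  have hone : (if f m = c then 1 else 0) + (if f (m + 1) = c then 1 else 0) +
      (if f (m + 2) = c then 1 else 0) + (if f (m + 3) = c then 1 else 0) ≤ 1 := by
    split_ifs <;> simp_all
  omega

theorem exists_mem_notMem_of_card_lt {L F : Finset C} (h : F.card < L.card) :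
    ∃ c ∈ L, c ∉ F := by
  by_contra! hc
  exact absurd (Finset.card_le_card hc) (by omega)

/-- Greedy balanced coloring of the square of a path. The lists may be shorter than `k`: it is enough
that each exceeds 2 and the size of the partial group at that vertex. -/
theorem exists_balanced_pathSquare_run [Nonempty C] (hk : 3 ≤ k) (B : Finset C) (hB : B.card < k)
    (L : ℕ → Finset C) (n : ℕ)
    (hL : ∀ i < n, 2 < (L i).card ∧ (B.card + i) % k < (L i).card) :
    ∃ f B', IsSquareProper f n ∧ (∀ i < n, f i ∈ L i) ∧ IsBalancedRun k B f n B' := by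
  obtain ⟨f₀⟩ : Nonempty (ℕ → C) := inferInstance
  -- Strengthen: `F` collects the colors forbidden at the next vertex, and it is small because a
  -- nonempty `B'` already contains the last color.
  suffices h : ∃ f B', IsSquareProper f n ∧ (∀ i < n, f i ∈ L i) ∧ IsBalancedRun k B f n B' ∧
      ∃ F, B' ⊆ F ∧ F.card ≤ max 2 B'.card ∧ (∀ i < n, n ≤ i + 2 → f i ∈ F) ∧
        (1 ≤ B'.card → ∀ i < n, n ≤ i + 1 → f i ∈ B') by
    obtain ⟨f, B', h1, h2, h3, -⟩ := h
    exact ⟨f, B', h1, h2, h3⟩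
  induction n with
  | zero =>
    exact ⟨f₀, B, fun i j _ hj => absurd hj (by omega), fun i hi => absurd hi (by omega),
      isBalancedRun_zero hB, B, le_rfl, le_max_right _ _, fun i hi => absurd hi (by omega),
      fun _ i hi => absurd hi (by omega)⟩
  | succ n ih =>
    obtain ⟨f, B', h1, h2, h3, F, hBF, hF, hlast2, hlast⟩ := ih fun i hi => hL i (by omega)
    obtain ⟨hL2, hLk⟩ := hL n (by omega)
    obtain ⟨c, hcL, hcF⟩ := exists_mem_notMem_of_card_lt (L := L n) (F := F) (by
      rw [h3.1] at hF; omega)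
    set g : ℕ → C := Function.update f n c with hg
    have hgn : g n = c := by simp [hg]
    have hgf : ∀ i < n, g i = f i := fun i hi => by simp [hg, hi.ne]
    have hrun := (h3.congr hgf).succ (by omega) (by rw [hgn]; exact fun h => hcF (hBF h))
    rw [hgn] at hrun
    refine ⟨g, _, ?_, ?_, hrun, ?_⟩
    · intro i j hij hj hd
      rcases Nat.lt_succ_iff_lt_or_eq.1 hj with hj' | rfl
      · rw [hgf i (by omega), hgf j hj']
        exact h1 i j hij hj' hd
      · rw [hgn, hgf i hij]
        exact fun h => hcF (h ▸ hlast2 i hij (by omega))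
    · intro i hi
      rcases Nat.lt_succ_iff_lt_or_eq.1 hi with hi' | rfl
      · rw [hgf i hi']
        exact h2 i hi'
      · rwa [hgn]
    · have hpair : ∀ i < n + 1, n + 1 ≤ i + 2 → g i ∈ ({g (n - 1), c} : Finset C) := by
        intro i hi hi'
        obtain rfl | rfl : i = n ∨ i = n - 1 := by omega
        · simp [hgn]
        · simp
      have hcn : ∀ i < n + 1, n + 1 ≤ i + 1 → g i = c := by
        intro i hi hi'
        obtain rfl : i = n := by omega
        exact hgn
      split_ifs with hk'
      · exact ⟨{g (n - 1), c}, by simp, Finset.card_le_two.trans (le_max_left _ _), hpair,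
          by simp⟩
      · have hc2 : ∀ i < n + 1, n + 1 ≤ i + 1 → g i ∈ insert c B' := fun i hi hi' => by
          rw [hcn i hi hi']; exact Finset.mem_insert_self _ _
        rcases Finset.eq_empty_or_nonempty B' with rfl | hne
        · exact ⟨{g (n - 1), c}, by simp, Finset.card_le_two.trans (le_max_left _ _), hpair,
            fun _ => hc2⟩
        · refine ⟨insert c B', le_rfl, le_max_right _ _, fun i hi hi' => ?_, fun _ => hc2⟩
          rcases Nat.lt_succ_iff_lt_or_eq.1 hi with hi'' | rfl
          · rw [hgf i hi'']
            exact Finset.mem_insert_of_mem (hlast hne.card_pos i hi'' (by omega))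
          · exact hc2 i hi (by omega)

end Runs

/-! ### Groups of four and squares of cycles -/

section Groups

open Finset

variable {C : Type*} [DecidableEq C] {m : ℕ} {B B' : Finset C} {f : ℕ → C}

/-- A proper balanced run can be continued by four distinct colors `a b c d`, where `a` avoids the
last two colors and `b` the last one. -/
theorem exists_appendFour (hf : IsSquareProper f m) (hrun : IsBalancedRun 4 B f m B')
    {L : ℕ → Finset C} (hfL : ∀ i < m, f i ∈ L i) {a b c d : C}
    (ha : a ∈ L m) (hb : b ∈ L (m + 1)) (hc : c ∈ L (m + 2)) (hd : d ∈ L (m + 3))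
    (hab : a ≠ b) (hac : a ≠ c) (had : a ≠ d) (hbc : b ≠ c) (hbd : b ≠ d) (hcd : c ≠ d)
    (ha1 : ∀ i < m, m ≤ i + 2 → f i ≠ a) (hb1 : ∀ i < m, m ≤ i + 1 → f i ≠ b) :
    ∃ g : ℕ → C, IsSquareProper g (m + 4) ∧ IsBalancedRun 4 B g (m + 4) B' ∧
      (∀ i < m + 4, g i ∈ L i) ∧ (∀ i < m, g i = f i) ∧
      g m = a ∧ g (m + 1) = b ∧ g (m + 2) = c ∧ g (m + 3) = d := by
  let g : ℕ → C := fun i => if i < m then f i else if i = m then a else if i = m + 1 then b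
    else if i = m + 2 then c else d
  have g0 : ∀ i < m, g i = f i := fun i hi => if_pos hi
  have ga : g m = a := by simp [g]
  have gb : g (m + 1) = b := by simp [g]
  have gc : g (m + 2) = c := by simp [g]
  have gd : g (m + 3) = d := by simp [g]
  have cases4 : ∀ j, ¬ j < m → j < m + 4 → j = m ∨ j = m + 1 ∨ j = m + 2 ∨ j = m + 3 := by
    intro j; omega
  have hinj : ∀ i j, m ≤ i → i < j → j < m + 4 → g i ≠ g j := by
    intro i j hi hij hj
    rcases cases4 i (by omega) (by omega) with rfl | rfl | rfl | rfl <;>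
    rcases cases4 j (by omega) (by omega) with rfl | rfl | rfl | rfl <;>
    first
    | omega
    | simpa only [ga, gb, gc, gd]
  refine ⟨g, ?_, (hrun.congr g0).add_four hinj, ?_, g0, ga, gb, gc, gd⟩
  · intro i j hij hj hd'
    by_cases him : i < m
    · by_cases hjm : j < m
      · rw [g0 i him, g0 j hjm]
        exact hf i j hij hjm hd'
      · rw [g0 i him]
        obtain rfl | rfl : j = m ∨ j = m + 1 := by omega
        · rw [ga]; exact ha1 i him hd'
        · rw [gb]; exact hb1 i him (by omega)
    · exact hinj i j (by omega) hij hj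
  · intro i hi
    by_cases him : i < m
    · rw [g0 i him]; exact hfL i him
    · rcases cases4 i him hi with rfl | rfl | rfl | rfl
      · rwa [ga]
      · rwa [gb]
      · rwa [gc]
      · rwa [gd]

/-- A full group can be appended to a run such that its last color avoids one color, which may depend
on the color of vertex `0`: choosing the colors in the order `a b d c`, there is always one left. -/
theorem exists_append_group (hf : IsSquareProper f m) (hrun : IsBalancedRun 4 B f m B')
    {L : ℕ → Finset C} (hfL : ∀ i < m, f i ∈ L i)
    (hL : ∀ i < m + 4, (L i).card = 4) (z : C → C) :
    ∃ g : ℕ → C, IsSquareProper g (m + 4) ∧ IsBalancedRun 4 B g (m + 4) B' ∧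
      (∀ i < m + 4, g i ∈ L i) ∧ g (m + 3) ≠ z (g 0) := by
  obtain ⟨a, ha, ha'⟩ := exists_mem_notMem_of_card_lt (L := L m) (F := {f (m - 1), f (m - 2)})
    (by rw [hL m (by omega)]; exact Finset.card_le_two.trans_lt (by omega))
  obtain ⟨b, hb, hb'⟩ := exists_mem_notMem_of_card_lt (L := L (m + 1)) (F := {f (m - 1), a})
    (by rw [hL _ (by omega)]; exact Finset.card_le_two.trans_lt (by omega))
  -- The color of vertex `0`, which is the new color `a` when `m = 0`.
  let s : C := if m = 0 then a else f 0
  obtain ⟨d, hd, hd'⟩ := exists_mem_notMem_of_card_lt (L := L (m + 3)) (F := {a, b, z s})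
    (by rw [hL _ (by omega)]; exact Finset.card_le_three.trans_lt (by omega))
  obtain ⟨c, hc, hc'⟩ := exists_mem_notMem_of_card_lt (L := L (m + 2)) (F := {a, b, d})
    (by rw [hL _ (by omega)]; exact Finset.card_le_three.trans_lt (by omega))
  simp only [Finset.mem_insert, Finset.mem_singleton, not_or] at ha' hb' hc' hd'
  obtain ⟨g, h1, h2, h3, h4, h5, -, -, h8⟩ := exists_appendFour hf hrun hfL ha hb hc hd
    (Ne.symm hb'.2) (Ne.symm hc'.1) (Ne.symm hd'.1) (Ne.symm hc'.2.1) (Ne.symm hd'.2.1) hc'.2.2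
    (fun i hi hi' => by
      obtain rfl | rfl : i = m - 1 ∨ i = m - 2 := by omega
      · exact Ne.symm ha'.1
      · exact Ne.symm ha'.2)
    (fun i hi hi' => by
      obtain rfl : i = m - 1 := by omega
      exact Ne.symm hb'.1)
  refine ⟨g, h1, h2, h3, ?_⟩
  have hs : g 0 = s := by
    by_cases hm : m = 0
    · subst hm; simpa [s] using h5
    · rw [h4 0 (by omega)]; simp [s, hm]
  rw [h8, hs]
  exact hd'.2.2

theorem exists_append_groups (hf : IsSquareProper f m) (hrun : IsBalancedRun 4 B f m B')
    {L : ℕ → Finset C} (hfL : ∀ i < m, f i ∈ L i) (q : ℕ)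
    (hL : ∀ i < m + 4 * q, (L i).card = 4) :
    ∃ g : ℕ → C, IsSquareProper g (m + 4 * q) ∧ IsBalancedRun 4 B g (m + 4 * q) B' ∧
      ∀ i < m + 4 * q, g i ∈ L i := by
  induction q with
  | zero => exact ⟨f, hf, hrun, hfL⟩
  | succ q ih =>
    obtain ⟨g, h1, h2, h3⟩ := ih fun i hi => hL i (by omega)
    obtain ⟨g', h1', h2', h3', -⟩ := exists_append_group h1 h2 h3 hL id
    exact ⟨g', h1', h2', h3'⟩

/-- The last group of a cycle, whose vertices `c` and `d` are also joined to the vertices `0` and `1`.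
It can be colored once the lists of `b` and `c`, without the color forbidden from outside, have four
colors in total: `a` and `d` take any distinct colors, and `b` and `c` have at least one color left
each, not both the same single one. -/
theorem exists_append_last_group (hm : 2 ≤ m) (hf : IsSquareProper f m)
    (hrun : IsBalancedRun 4 B f m B') {L : ℕ → Finset C} (hfL : ∀ i < m, f i ∈ L i)
    (hL : ∀ i < m + 4, (L i).card = 4)
    (hgood : 4 ≤ ((L (m + 1)).erase (f (m - 1)) ∪ (L (m + 2)).erase (f 0)).card) :
    ∃ g : ℕ → C, IsSquareProper g (m + 4) ∧ IsBalancedRun 4 B g (m + 4) B' ∧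
      (∀ i < m + 4, g i ∈ L i) ∧ g (m + 2) ≠ g 0 ∧ g (m + 3) ≠ g 0 ∧ g (m + 3) ≠ g 1 := by
  obtain ⟨a, ha, ha'⟩ := exists_mem_notMem_of_card_lt (L := L m) (F := {f (m - 1), f (m - 2)})
    (by rw [hL m (by omega)]; exact Finset.card_le_two.trans_lt (by omega))
  obtain ⟨d, hd, hd'⟩ := exists_mem_notMem_of_card_lt (L := L (m + 3)) (F := {f 0, f 1, a})
    (by rw [hL _ (by omega)]; exact Finset.card_le_three.trans_lt (by omega))
  simp only [Finset.mem_insert, Finset.mem_singleton, not_or] at ha' hd'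
  set X := (L (m + 1)).erase (f (m - 1)) with hX
  set Y := (L (m + 2)).erase (f 0) with hY
  have hXc : 3 ≤ X.card := by
    have := Finset.pred_card_le_card_erase (s := L (m + 1)) (a := f (m - 1))
    rw [hL _ (by omega)] at this
    exact this
  have hYc : 3 ≤ Y.card := by
    have := Finset.pred_card_le_card_erase (s := L (m + 2)) (a := f 0)
    rw [hL _ (by omega)] at this
    exact this
  obtain ⟨b, c, hb, hc, hbc, hba, hbd, hca, hcd⟩ : ∃ b c, b ∈ X ∧ c ∈ Y ∧ b ≠ c ∧ b ≠ a ∧ b ≠ d ∧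
      c ≠ a ∧ c ≠ d := by
    have hpair : ({a, d} : Finset C).card ≤ 2 := Finset.card_le_two
    obtain ⟨b, hb, hb'⟩ := exists_mem_notMem_of_card_lt (L := X) (F := {a, d}) (by omega)
    obtain ⟨c, hc, hc'⟩ := exists_mem_notMem_of_card_lt (L := Y) (F := {a, d}) (by omega)
    obtain ⟨e, he, he'⟩ := exists_mem_notMem_of_card_lt (L := X ∪ Y) (F := {b, a, d})
      (Finset.card_le_three.trans_lt (by omega))
    simp only [Finset.mem_insert, Finset.mem_singleton, not_or] at hb' hc' he'
    by_cases hbc : b = c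
    · -- Then `e`, which avoids this common color, replaces one of the two.
      rcases Finset.mem_union.1 he with he | he
      · exact ⟨e, c, he, hc, hbc ▸ he'.1, he'.2.1, he'.2.2, hc'.1, hc'.2⟩
      · exact ⟨b, e, hb, he, Ne.symm he'.1, hb'.1, hb'.2, he'.2.1, he'.2.2⟩
    · exact ⟨b, c, hb, hc, hbc, hb'.1, hb'.2, hc'.1, hc'.2⟩
  rw [hX, Finset.mem_erase] at hb
  rw [hY, Finset.mem_erase] at hc
  obtain ⟨g, h1, h2, h3, h4, -, -, h7, h8⟩ := exists_appendFour hf hrun hfL ha hb.2 hc.2 hd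
    (Ne.symm hba) (Ne.symm hca) (Ne.symm hd'.2.2) hbc hbd hcd
    (fun i hi hi' => by
      obtain rfl | rfl : i = m - 1 ∨ i = m - 2 := by omega
      · exact Ne.symm ha'.1
      · exact Ne.symm ha'.2)
    (fun i hi hi' => by
      obtain rfl : i = m - 1 := by omega
      exact Ne.symm hb.1)
  refine ⟨g, h1, h2, h3, ?_, ?_, ?_⟩
  · rw [h7, h4 0 (by omega)]; exact hc.1
  · rw [h8, h4 0 (by omega)]; exact hd'.1
  · rw [h8, h4 1 (by omega)]; exact hd'.2.1

/-- For a given `y`, at most one `x` violates the condition on the last group. -/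
theorem exists_forall_ne_four_le_card_union {S T : Finset C} (hS : S.card = 4) (hT : T.card = 4)
    (y : C) : ∃ z, ∀ x ≠ z, 4 ≤ (S.erase x ∪ T.erase y).card := by
  have hTy := Finset.pred_card_le_card_erase (s := T) (a := y)
  by_cases hc : (T.erase y).card = 4
  · exact ⟨y, fun x _ => hc.symm.le.trans (Finset.card_le_card Finset.subset_union_right)⟩
  · have hlt : (T.erase y).card < S.card := by
      have := Finset.card_erase_le (s := T) (a := y)
      omega
    obtain ⟨z, hzS, hzT⟩ := exists_mem_notMem_of_card_lt hlt
    refine ⟨z, fun x hx => ?_⟩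
    have hsub : insert z (T.erase y) ⊆ S.erase x ∪ T.erase y :=
      Finset.insert_subset (Finset.mem_union_left _ (Finset.mem_erase.2 ⟨hx.symm, hzS⟩))
        Finset.subset_union_right
    have := Finset.card_le_card hsub
    rw [Finset.card_insert_of_notMem hzT] at this
    omega

/-- Among the pairs `x ≠ y`, at most one violates the condition on the last group. -/
theorem exists_pair_forall_four_le_card_union {S T : Finset C} (hS : S.card = 4)
    (hT : T.card = 4) : ∃ x₀ y₀, ∀ x y, x ≠ y → x ≠ x₀ ∨ y ≠ y₀ →
      4 ≤ (S.erase x ∪ T.erase y).card := by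
  by_cases hST : S = T
  · subst hST
    obtain ⟨s, -⟩ : S.Nonempty := Finset.card_pos.1 (by omega)
    refine ⟨s, s, fun x y hxy _ => ?_⟩
    have hsub : S ⊆ S.erase x ∪ S.erase y := fun c hc => by
      by_cases hcx : c = x
      · exact Finset.mem_union_right _ (Finset.mem_erase.2 ⟨hcx ▸ hxy, hc⟩)
      · exact Finset.mem_union_left _ (Finset.mem_erase.2 ⟨hcx, hc⟩)
    exact hS.symm.le.trans (Finset.card_le_card hsub)
  · obtain ⟨x₀, hx₀, hx₀'⟩ := Finset.not_subset.1 fun h =>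
      hST (Finset.eq_of_subset_of_card_le h (by omega))
    obtain ⟨y₀, hy₀, hy₀'⟩ := Finset.not_subset.1 fun h =>
      hST (Finset.eq_of_subset_of_card_le h (by omega)).symm
    refine ⟨x₀, y₀, fun x y _ h => ?_⟩
    have hSx := Finset.pred_card_le_card_erase (s := S) (a := x)
    have hTy := Finset.pred_card_le_card_erase (s := T) (a := y)
    rcases h with h | h
    · have hsub : insert x₀ (T.erase y) ⊆ S.erase x ∪ T.erase y :=
        Finset.insert_subset (Finset.mem_union_left _ (Finset.mem_erase.2 ⟨h.symm, hx₀⟩))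
          Finset.subset_union_right
      have := Finset.card_le_card hsub
      rw [Finset.card_insert_of_notMem fun h' => hx₀' (Finset.mem_of_mem_erase h')] at this
      omega
    · have hsub : insert y₀ (S.erase x) ⊆ S.erase x ∪ T.erase y :=
        Finset.insert_subset (Finset.mem_union_right _ (Finset.mem_erase.2 ⟨h.symm, hy₀⟩))
          Finset.subset_union_left
      have := Finset.card_le_card hsub
      rw [Finset.card_insert_of_notMem fun h' => hy₀' (Finset.mem_of_mem_erase h')] at this
      omega

/-- Balanced coloring of the square of a cycle on `n ≥ 6` vertices from lists of size 4. -/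
theorem exists_balanced_cycleSquare_run [Nonempty C] {n : ℕ} (hn : 6 ≤ n) (B : Finset C)
    (hB : B.card < 4) (L : ℕ → Finset C) (hL : ∀ i < n, (L i).card = 4) :
    ∃ f B', IsSquareProper f n ∧ (∀ i < n, f i ∈ L i) ∧ IsBalancedRun 4 B f n B' ∧
      f (n - 2) ≠ f 0 ∧ f (n - 1) ≠ f 0 ∧ f (n - 1) ≠ f 1 := by
  suffices h : ∃ m f B', m + 4 = n ∧ IsSquareProper f m ∧ (∀ i < m, f i ∈ L i) ∧
      IsBalancedRun 4 B f m B' ∧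
      4 ≤ ((L (m + 1)).erase (f (m - 1)) ∪ (L (m + 2)).erase (f 0)).card by
    obtain ⟨m, f, B', rfl, h1, h2, h3, h4⟩ := h
    obtain ⟨g, k1, k2, k3, k4, k5, k6⟩ := exists_append_last_group (by omega) h1 h3 h2 hL h4
    exact ⟨g, B', k1, k3, k2, k4, k5, k6⟩
  by_cases hn8 : 8 ≤ n
  · -- First `n % 4` vertices, then groups of four; the last vertex before the final group avoids
    -- the only color that would spoil that group.
    obtain ⟨f, B', h1, h2, h3⟩ := exists_balanced_pathSquare_run (k := 4) (by omega) B hB L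
      (n % 4) fun i hi => by rw [hL i (by omega)]; omega
    obtain ⟨q, hq⟩ : ∃ q, n = n % 4 + 4 * q + 4 + 4 := ⟨n / 4 - 2, by omega⟩
    obtain ⟨g, k1, k2, k3⟩ := exists_append_groups h1 h3 h2 q fun i hi => hL i (by omega)
    set m := n % 4 + 4 * q
    choose z hz using exists_forall_ne_four_le_card_union
      (hL (m + 4 + 1) (by omega)) (hL (m + 4 + 2) (by omega))
    obtain ⟨g', l1, l2, l3, l4⟩ := exists_append_group k1 k2 k3 (fun i hi => hL i (by omega)) z
    exact ⟨m + 4, g', B', hq.symm, l1, l3, l2, hz _ _ l4⟩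
  · obtain ⟨r, hr, hr2, hr3⟩ : ∃ r, r + 4 = n ∧ 2 ≤ r ∧ r ≤ 3 := ⟨n - 4, by omega⟩
    obtain ⟨x₀, y₀, hxy⟩ := exists_pair_forall_four_le_card_union
      (hL (r + 1) (by omega)) (hL (r + 2) (by omega))
    -- One end of the initial segment gets a shorter list: the first one if `B` leaves room
    -- for it, and else the last one, for which `B` has been completed and discarded.
    have key : ∀ j w, j < r → (B.card + j) % 4 < 3 → ∃ f B', IsSquareProper f r ∧
        (∀ i < r, f i ∈ L i) ∧ IsBalancedRun 4 B f r B' ∧ f j ≠ w := by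
      intro j w hj hBj
      obtain ⟨f, B', h1, h2, h3⟩ := exists_balanced_pathSquare_run (k := 4) (by omega) B hB
        (Function.update L j ((L j).erase w)) r fun i hi => by
          by_cases hij : i = j
          · subst hij
            have := Finset.pred_card_le_card_erase (s := L i) (a := w)
            rw [hL i (by omega)] at this
            rw [Function.update_self]
            omega
          · rw [Function.update_of_ne hij, hL i (by omega)]
            omega
      refine ⟨f, B', h1, fun i hi => ?_, h3, ?_⟩
      · have := h2 i hi
        by_cases hij : i = j
        · subst hij
          rw [Function.update_self] at this
          exact Finset.mem_of_mem_erase this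
        · rwa [Function.update_of_ne hij] at this
      · have := h2 j hj
        rw [Function.update_self] at this
        exact Finset.ne_of_mem_erase this
    by_cases hB3 : B.card < 3
    · obtain ⟨f, B', h1, h2, h3, h4⟩ := key 0 y₀ (by omega) (by omega)
      exact ⟨r, f, B', hr, h1, h2, h3, hxy _ _
        (h1 0 (r - 1) (by omega) (by omega) (by omega)).symm (Or.inr h4)⟩
    · obtain ⟨f, B', h1, h2, h3, h4⟩ := key (r - 1) x₀ (by omega) (by omega)
      exact ⟨r, f, B', hr, h1, h2, h3, hxy _ _
        (h1 0 (r - 1) (by omega) (by omega) (by omega)).symm (Or.inl h4)⟩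

end Groups

/-! ### Balanced choosability of the components -/

section Components

open Finset

/-- `H` is balanced `k`-choosable: from lists of size `k` and any set `B` of fewer than `k` colors
(of a partly filled group of `k` vertices outside `H`), it has a proper list coloring after which
every color is used at most once per full group, counting the vertices of `B` as well, and once more
if it belongs to the new partial group `B'`. -/
def IsBalancedChoosable {W : Type*} [Fintype W] (H : SimpleGraph W) (k : ℕ) : Prop :=
  ∀ (C : Type) [DecidableEq C] (L : W → Finset C), (∀ v, (L v).card = k) →
    ∀ B : Finset C, B.card < k → ∃ (f : H.Coloring C) (B' : Finset C), (∀ v, f v ∈ L v) ∧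
      B'.card = (B.card + Fintype.card W) % k ∧
      ∀ c, (univ.filter fun v => f v = c).card + (if c ∈ B then 1 else 0) ≤
        (B.card + Fintype.card W) / k + (if c ∈ B' then 1 else 0)

variable {W W' : Type*} [Fintype W] [Fintype W'] {H : SimpleGraph W} {H' : SimpleGraph W'} {k : ℕ}

theorem IsBalancedChoosable.of_iso (h : IsBalancedChoosable H' k) (e : H ≃g H') :
    IsBalancedChoosable H k := by
  intro C _ L hL B hB
  obtain ⟨f, B', h1, h2, h3⟩ := h C (fun w => L (e.symm w)) (fun w => hL _) B hB
  have hc : Fintype.card W = Fintype.card W' := Fintype.card_congr e.toEquiv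
  refine ⟨f.comp e.toHom, B', fun v => ?_, by rw [hc]; exact h2, fun c => ?_⟩
  · have := h1 (e v)
    rwa [RelIso.symm_apply_apply] at this
  · rw [hc]
    refine le_trans (Nat.add_le_add_right ?_ _) (h3 c)
    refine Finset.card_le_card_of_injOn e (fun v hv => ?_) e.injective.injOn
    simpa using hv

theorem isBalancedChoosable_of_isEmpty [IsEmpty W] : IsBalancedChoosable H k := by
  intro C _ L _ B hB
  exact ⟨SimpleGraph.Coloring.mk isEmptyElim fun {v} => isEmptyElim v, B, isEmptyElim,
    by simp [Nat.mod_eq_of_lt hB], fun c => by simp⟩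

/-- It suffices to color a graph on `Fin n` by balanced runs. The colors may be assumed nonempty,
because the lists are, unless `n = 0`. -/
theorem isBalancedChoosable_of_run {n : ℕ} {H : SimpleGraph (Fin n)}
    (h : ∀ (C : Type) [DecidableEq C] [Nonempty C] (L : ℕ → Finset C),
      (∀ i < n, (L i).card = k) → ∀ B : Finset C, B.card < k →
      ∃ (f : ℕ → C) (B' : Finset C), (∀ u v : Fin n, H.Adj u v → f u ≠ f v) ∧
        (∀ i < n, f i ∈ L i) ∧ IsBalancedRun k B f n B') :
    IsBalancedChoosable H k := by
  rcases Nat.eq_zero_or_pos n with rfl | hn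
  · exact isBalancedChoosable_of_isEmpty
  intro C _ L hL B hB
  obtain ⟨c₀, -⟩ : (L ⟨0, hn⟩).Nonempty := Finset.card_pos.1 (by rw [hL]; omega)
  have : Nonempty C := ⟨c₀⟩
  obtain ⟨f, B', h1, h2, h3, h4⟩ := h C (fun i => if hi : i < n then L ⟨i, hi⟩ else ∅)
    (fun i hi => by simp only [dif_pos hi, hL]) B hB
  refine ⟨SimpleGraph.Coloring.mk (fun i => f i) fun {u v} => h1 u v, B', fun v => ?_, ?_,
    fun c => ?_⟩
  · have := h2 v v.2
    rwa [dif_pos v.2] at this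
  · rw [Fintype.card_fin]; exact h3
  · have := h4 c
    rw [Fintype.card_fin]
    rw [Finset.card_filter, Finset.sum_range] at this
    rw [Finset.card_filter]
    exact this

theorem IsPathSquare.isBalancedChoosable (h : IsPathSquare H) (hk : 3 ≤ k) :
    IsBalancedChoosable H k := by
  obtain ⟨n, ⟨e⟩⟩ := h
  refine IsBalancedChoosable.of_iso (isBalancedChoosable_of_run fun C _ _ L hL B hB => ?_) e
  obtain ⟨f, B', h1, h2, h3⟩ := exists_balanced_pathSquare_run hk B hB L n fun i hi => by
    rw [hL i hi]
    exact ⟨by omega, Nat.mod_lt _ (by omega)⟩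
  refine ⟨f, B', fun u v huv => ?_, h2, h3⟩
  obtain ⟨hne, hu, hv⟩ := pathSquare_adj_val huv
  rcases lt_or_gt_of_ne (Fin.val_ne_of_ne hne) with hlt | hlt
  · exact h1 u v hlt v.2 hv
  · exact (h1 v u hlt u.2 hu).symm

theorem IsCycleSquare.isBalancedChoosable_four (h : IsCycleSquare H) :
    IsBalancedChoosable H 4 := by
  obtain ⟨n, hn, ⟨e⟩⟩ := h
  refine IsBalancedChoosable.of_iso (isBalancedChoosable_of_run fun C _ _ L hL B hB => ?_) e
  obtain ⟨f, B', h1, h2, h3, h4, h5, h6⟩ := exists_balanced_cycleSquare_run hn B hB L hL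
  have key : ∀ u v : Fin n, u < v → (graphPower (SimpleGraph.cycleGraph n) 2).Adj u v →
      f u ≠ f v := by
    intro u v hlt huv
    have hlt' : (u : ℕ) < v := hlt
    have hv := v.2
    obtain ⟨-, ⟨-, hd⟩ | hd | hd⟩ := (cycleSquare_adj_val hn).1 huv
    · exact h1 u v hlt v.2 hd
    · omega
    · obtain ⟨hu0, hvn⟩ | ⟨hu0, hvn⟩ | ⟨hu0, hvn⟩ : ((u : ℕ) = 0 ∧ (v : ℕ) = n - 2) ∨
          ((u : ℕ) = 0 ∧ (v : ℕ) = n - 1) ∨ ((u : ℕ) = 1 ∧ (v : ℕ) = n - 1) := by omega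
      · rw [hu0, hvn]; exact h4.symm
      · rw [hu0, hvn]; exact h5.symm
      · rw [hu0, hvn]; exact h6.symm
  refine ⟨f, B', fun u v huv => ?_, h2, h3⟩
  rcases lt_or_gt_of_ne huv.ne with hlt | hlt
  · exact key u v hlt huv
  · exact (key v u hlt huv.symm).symm

/-- A copy of `K₄` is one full group; its first and last vertex differ by the choice `z = id`. -/
theorem IsK4.isBalancedChoosable_four (h : IsK4 H) : IsBalancedChoosable H 4 := by
  obtain ⟨e⟩ := h
  refine IsBalancedChoosable.of_iso (isBalancedChoosable_of_run fun C _ _ L hL B hB => ?_) e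
  obtain ⟨f₀⟩ : Nonempty (ℕ → C) := inferInstance
  obtain ⟨g, h1, h2, h3, h4⟩ := exists_append_group (m := 0) (f := f₀) (B := B) (B' := B) (L := L)
    (fun _ _ _ hj => absurd hj (Nat.not_lt_zero _)) (isBalancedRun_zero hB)
    (fun _ hi => absurd hi (Nat.not_lt_zero _)) hL id
  have key : ∀ u v : Fin 4, u < v → g u ≠ g v := by
    intro u v huv
    have huv' : (u : ℕ) < v := huv
    by_cases hd : (v : ℕ) ≤ u + 2
    · exact h1 u v huv v.2 hd
    · obtain ⟨hu, hv⟩ : (u : ℕ) = 0 ∧ (v : ℕ) = 0 + 3 := by omega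
      rw [hu, hv]
      exact h4.symm
  refine ⟨g, B, fun u v huv => ?_, h3, h2⟩
  rcases lt_or_gt_of_ne huv.ne with hlt | hlt
  · exact key u v hlt
  · exact (key v u hlt).symm

/-- A color occurs at most once among three consecutive vertices. -/
theorem card_color_class_cycleSquare_le {m : ℕ} (hm : 6 ≤ 3 * m) {C : Type*} [DecidableEq C]
    (f : (graphPower (SimpleGraph.cycleGraph (3 * m)) 2).Coloring C) (c : C) :
    (univ.filter fun v => f v = c).card ≤ m := by
  have hinj : Set.InjOn (fun v : Fin (3 * m) => (v : ℕ) / 3)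
      (univ.filter fun v => f v = c : Finset (Fin (3 * m))) := by
    intro u hu v hv huv
    simp only [Finset.coe_filter, Finset.mem_univ, true_and, Set.mem_ofPred_eq] at hu hv huv
    by_contra hne
    exact f.valid ((cycleSquare_adj_val hm).2 ⟨hne, Or.inl ⟨by omega, by omega⟩⟩)
      (hu.trans hv.symm)
  have := Finset.card_le_card_of_injOn (t := Finset.range m) _ (fun v _ => by
    have := v.2
    simp only [Finset.coe_range, Set.mem_Iio]
    omega) hinj
  simpa using this

theorem exists_cycleSquare_listColoring {m : ℕ} (hm : 6 ≤ 3 * m) {C : Type*} [DecidableEq C]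
    (L : Fin (3 * m) → Finset C) (hL : ∀ v, (L v).card = 3) :
    ∃ f : (graphPower (SimpleGraph.cycleGraph (3 * m)) 2).Coloring C, ∀ v, f v ∈ L v := by
  -- The successor on the cycle.
  let s : Fin (3 * m) → Fin (3 * m) := fun i =>
    if h : (i : ℕ) + 1 < 3 * m then ⟨i + 1, h⟩ else ⟨0, by omega⟩
  have hs : ∀ i, ((s i : ℕ) = i + 1 ∧ (i : ℕ) + 1 < 3 * m) ∨
      ((s i : ℕ) = 0 ∧ (i : ℕ) + 1 = 3 * m) := by
    intro i
    have := i.2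
    by_cases h : (i : ℕ) + 1 < 3 * m
    · exact Or.inl ⟨by simp [s, h], h⟩
    · exact Or.inr ⟨by simp [s, h], by omega⟩
  obtain ⟨f, hfL, hf⟩ := exists_listColoring_of_card_eq_three s
    (fun i => (⟨(i : ℕ) % 3, Nat.mod_lt _ (by norm_num)⟩ : Fin 3))
    (fun i h => by
      rw [Fin.mk.injEq] at h
      have := hs i
      omega)
    (fun i h => by
      rw [Fin.mk.injEq] at h
      have := hs i
      have := hs (s i)
      omega) L hL
  refine ⟨SimpleGraph.Coloring.mk f fun {u v} huv => ?_, hfL⟩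
  obtain ⟨hne, huv⟩ := (cycleSquare_adj_val hm).1 huv
  have hne' : (u : ℕ) ≠ v := fun h => hne (Fin.ext h)
  have hu := u.2
  have hv := v.2
  have hsu := hs u
  have hsu' := hs (s u)
  have hsv := hs v
  have hsv' := hs (s v)
  obtain h | h | h | h : s u = v ∨ s (s u) = v ∨ s v = u ∨ s (s v) = u := by
    simp only [Fin.ext_iff]
    omega
  · exact h ▸ (hf u).1
  · exact h ▸ (hf u).2
  · exact h ▸ (hf v).1.symm
  · exact h ▸ (hf v).2.symm

theorem IsCycleSquare.isBalancedChoosable_three (h : IsCycleSquare H)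
    (hdvd : 3 ∣ Fintype.card W) : IsBalancedChoosable H 3 := by
  obtain ⟨n, hn, ⟨e⟩⟩ := h
  rw [Fintype.card_congr e.toEquiv, Fintype.card_fin] at hdvd
  obtain ⟨m, rfl⟩ := hdvd
  refine IsBalancedChoosable.of_iso (fun C _ L hL B hB => ?_) e
  obtain ⟨f, hf⟩ := exists_cycleSquare_listColoring hn L hL
  refine ⟨f, B, hf, by rw [Fintype.card_fin]; omega, fun c => ?_⟩
  have := card_color_class_cycleSquare_le hn f c
  have e3 : (B.card + 3 * m) / 3 = m := by omega
  rw [Fintype.card_fin, e3]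
  omega

end Components

/-! ### Equitable colorings from the components -/

section Union

open Finset

/-- Color the components one after the other, passing on the partial group. -/
theorem isEquitablyChoosable_of_components {V : Type*} [Fintype V] (G : SimpleGraph V) {k : ℕ}
    (hk : 0 < k)
    (h : ∀ (K : G.ConnectedComponent) [Fintype K], IsBalancedChoosable K.toSimpleGraph k) :
    IsEquitablyChoosable G k := by
  classical
  intro C _ L hL
  rcases isEmpty_or_nonempty V with hV | ⟨⟨v₀⟩⟩
  · exact ⟨SimpleGraph.Coloring.mk isEmptyElim fun {v} => isEmptyElim v, isEmptyElim,
      fun c => by simp⟩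
  obtain ⟨c₀, -⟩ : (L v₀).Nonempty := Finset.card_pos.1 (by rw [hL]; exact hk)
  let comp : V → G.ConnectedComponent := G.connectedComponentMk
  have key : ∀ T : Finset G.ConnectedComponent, ∃ (f : V → C) (B : Finset C),
      (∀ v, comp v ∈ T → f v ∈ L v) ∧ (∀ u v, comp u ∈ T → G.Adj u v → f u ≠ f v) ∧
      B.card = (univ.filter fun v => comp v ∈ T).card % k ∧
      ∀ c, (univ.filter fun v => comp v ∈ T ∧ f v = c).card ≤
        (univ.filter fun v => comp v ∈ T).card / k + (if c ∈ B then 1 else 0) := by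
    intro T
    induction T using Finset.induction_on with
    | empty => exact ⟨fun _ => c₀, ∅, by simp, by simp, by simp, by simp⟩
    | insert K T hK ih =>
      obtain ⟨f, B, h1, h2, h3, h4⟩ := ih
      obtain ⟨g, B', k1, k2, k3⟩ := h K C (fun v => L v) (fun v => hL v) B
        (by rw [h3]; exact Nat.mod_lt _ hk)
      have hmem : ∀ v, comp v = K ↔ v ∈ K.supp := fun v => Iff.rfl
      let f' : V → C := fun v => if hv : v ∈ K.supp then g ⟨v, hv⟩ else f v
      have hfK : ∀ v (hv : v ∈ K.supp), f' v = g ⟨v, hv⟩ := fun v hv => dif_pos hv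
      have hfT : ∀ v, comp v ∈ T → f' v = f v := fun v hv =>
        dif_neg fun hv' => hK (by rw [← (hmem v).2 hv']; exact hv)
      have hcard : (univ.filter fun v => comp v ∈ insert K T).card =
          Fintype.card K + (univ.filter fun v => comp v ∈ T).card := by
        rw [Fintype.card_of_subtype (univ.filter fun v => comp v = K) (fun v => by simp [hmem]; rfl),
          ← Finset.card_union_of_disjoint]
        · congr 1
          ext v
          simp
        · rw [Finset.disjoint_left]
          intro v hv hv'
          simp only [Finset.mem_filter, Finset.mem_univ, true_and] at hv hv'
          exact hK (hv ▸ hv')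
      have hcardc : ∀ c, (univ.filter fun v => comp v ∈ insert K T ∧ f' v = c).card ≤
          (univ.filter fun v : K => g v = c).card +
            (univ.filter fun v => comp v ∈ T ∧ f v = c).card := by
        intro c
        rw [← Finset.card_map (Function.Embedding.subtype _)]
        refine (Finset.card_le_card ?_).trans (Finset.card_union_le _ _)
        intro v hv
        simp only [Finset.mem_filter, Finset.mem_univ, true_and, Finset.mem_insert] at hv
        obtain ⟨hv | hv, hvc⟩ := hv
        · have hv' := (hmem v).1 hv
          refine Finset.mem_union_left _ (Finset.mem_map.2 ⟨⟨v, hv'⟩, ?_, rfl⟩)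
          rw [hfK v hv'] at hvc
          simpa using hvc
        · rw [hfT v hv] at hvc
          exact Finset.mem_union_right _ (by simp [hv, hvc])
      have hN := Nat.div_add_mod (univ.filter fun v => comp v ∈ T).card k
      set N := (univ.filter fun v => comp v ∈ T).card
      have hsum : Fintype.card K + N = (B.card + Fintype.card K) + k * (N / k) := by
        omega
      refine ⟨f', B', ?_, ?_, ?_, ?_⟩
      · intro v hv
        rcases Finset.mem_insert.1 hv with hv | hv
        · rw [hfK v ((hmem v).1 hv)]
          exact k1 _
        · rw [hfT v hv]
          exact h1 v hv
      · intro u v hu huv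
        have huv' : comp v = comp u :=
          (SimpleGraph.ConnectedComponent.connectedComponentMk_eq_of_adj huv).symm
        rcases Finset.mem_insert.1 hu with hu | hu
        · rw [hfK u ((hmem u).1 hu), hfK v ((hmem v).1 (huv'.trans hu))]
          exact g.valid ((K.toSimpleGraph_adj _ _).2 huv)
        · rw [hfT u hu, hfT v (huv' ▸ hu)]
          exact h2 u v hu huv
      · rw [hcard, k2, hsum, Nat.add_mul_mod_self_left]
      · intro c
        rw [hcard, hsum, Nat.add_mul_div_left _ _ hk]
        have := hcardc c
        have := k3 c
        have := h4 c
        omega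
  obtain ⟨f, B, h1, h2, h3, h4⟩ := key univ
  refine ⟨SimpleGraph.Coloring.mk f fun {u v} => h2 u v (Finset.mem_univ _),
    fun v => h1 v (Finset.mem_univ _), fun c => ?_⟩
  simp only [Finset.mem_univ, true_and, Finset.filter_true, Finset.card_univ] at h3 h4
  refine (h4 c).trans ?_
  have hk' : (0 : ℚ) < k := by exact_mod_cast hk
  have hceil := Nat.le_ceil ((Fintype.card V : ℚ) / k)
  rw [div_le_iff₀ hk'] at hceil
  have hceil' : Fintype.card V ≤ ⌈(Fintype.card V : ℚ) / k⌉₊ * k := by exact_mod_cast hceil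
  have hdm := Nat.div_add_mod (Fintype.card V) k
  split_ifs with hcB
  · have hpos : 0 < Fintype.card V % k := h3 ▸ Finset.card_pos.2 ⟨c, hcB⟩
    by_contra hlt
    have hle : ⌈(Fintype.card V : ℚ) / k⌉₊ ≤ Fintype.card V / k := by omega
    have := Nat.mul_le_mul_left k hle
    rw [mul_comm] at hceil'
    omega
  · by_contra hlt
    have hle : ⌈(Fintype.card V : ℚ) / k⌉₊ + 1 ≤ Fintype.card V / k := by omega
    have := Nat.mul_le_mul_left k hle
    rw [mul_comm] at hceil'
    rw [mul_add] at this
    omega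

end Union

theorem theorem4 {V : Type*} [Fintype V] (G : SimpleGraph V)
    (hG : ∀ K : G.ConnectedComponent,
      IsPathSquare K.toSimpleGraph ∨ IsCycleSquare K.toSimpleGraph ∨ IsK4 K.toSimpleGraph) :
    IsEquitablyChoosable G 4 ∧
      (IsEquitablyChoosable G 3 ↔
        (∀ K : G.ConnectedComponent, ¬ IsK4 K.toSimpleGraph) ∧
        (∀ K : G.ConnectedComponent, IsCycleSquare K.toSimpleGraph → 3 ∣ Nat.card K.supp)) := by
  refine ⟨isEquitablyChoosable_of_components G (by omega) fun K _ => ?_, fun h => ?_,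
    fun ⟨h4, h3⟩ => isEquitablyChoosable_of_components G (by omega) fun K _ => ?_⟩
  · rcases hG K with h | h | h
    · exact h.isBalancedChoosable (by omega)
    · exact h.isBalancedChoosable_four
    · exact h.isBalancedChoosable_four
  · obtain ⟨f, -⟩ := h (Fin 3) (fun _ => Finset.univ) (fun _ => by simp)
    refine ⟨fun K ⟨e⟩ => ?_, fun K ⟨n, hn, ⟨e⟩⟩ => ?_⟩
    · let f' : SimpleGraph.Coloring _ (Fin 3) := (f.comp K.toSimpleGraph_hom).comp e.symm.toHom
      have hinj : Function.Injective f' := fun a b hab => by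
        by_contra hne
        exact SimpleGraph.Coloring.valid f' ((SimpleGraph.top_adj a b).2 hne) hab
      have := Fintype.card_le_of_injective _ hinj
      simp at this
    · change 3 ∣ Nat.card K
      rw [Nat.card_congr e.toEquiv, Nat.card_fin]
      exact three_dvd_of_cycleSquare_coloring hn
        ((f.comp K.toSimpleGraph_hom).comp e.symm.toHom)
  · rcases hG K with h | h | h
    · exact h.isBalancedChoosable le_rfl
    · exact h.isBalancedChoosable_three (by rw [← Nat.card_eq_fintype_card]; exact h3 K h)
    · exact absurd h (h4 K)
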